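/- Let $d\ge 1$ and $n\ge 1$ be integers. For a weight vector $w\in[0,1]^n$ and profit vectors $v^{(1)},\dots,v^{(d)}\in[0,1]^n$, the multiobjective $0$--$1$ knapsack problem asks to maximize the $d$ profits $v^{(i)}(x)=\sum_{j=1}^n v^{(i)}_j x_j$ and to minimize the weight $w(x)=\sum_{j=1}^n w_j x_j$ over all solutions $x\in\{0,1\}^n$. A solution $y$ dominates a solution $x$ if $v^{(i)}(y)\ge v^{(i)}(x)$ for all $i$ and $w(y)\le w(x)$, with at least one of these $d+1$ inequalities strict; a solution $x\in\{0,1\}^n$ is Pareto-optimal (a Pareto optimum) if no $y\in\{0,1\}^n$ dominates it. Theorem. For every $d\ge 1$ there is a constant $c_d>0$, depending only on $d$, such that for every $n\ge 1$ the following holds: if all the weights are $w_j=1$ and the $dn$ profits $v^{(i)}_j$ are independent and uniformly distributed on $[0,1]$, then the expected number of Pareto optima of the multiobjective $0$--$1$ knapsack problem is at least $c_d\, n^{d-3/2}$. -/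

import Mathlib

open MeasureTheory ProbabilityTheory

/-- The set `{0,1}^n` of solutions, as vectors in `ℝ^n`. -/
def binaryCube (n : ℕ) : Set (Fin n → ℝ) :=
  {x | ∀ j, x j = 0 ∨ x j = 1}

/-- In the knapsack problem with weight vector `w` (to be minimized) and profit vectors
`v 0, …, v (d - 1)` (to be maximized), `y` dominates `x`: it is at least as good as `x` in each
of the `d + 1` linear objectives and strictly better in at least one of them. -/
def KnapsackDominates {d n : ℕ} (w : Fin n → ℝ) (v : Fin d → Fin n → ℝ)
    (y x : Fin n → ℝ) : Prop :=
  (∀ i, v i ⬝ᵥ x ≤ v i ⬝ᵥ y) ∧ w ⬝ᵥ y ≤ w ⬝ᵥ x ∧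
    ((∃ i, v i ⬝ᵥ x < v i ⬝ᵥ y) ∨ w ⬝ᵥ y < w ⬝ᵥ x)

/-- The set of Pareto-optimal solutions of the knapsack problem with feasible set `{0,1}^n`. -/
def knapsackParetoSet {d n : ℕ} (w : Fin n → ℝ) (v : Fin d → Fin n → ℝ) :
    Set (Fin n → ℝ) :=
  {x | x ∈ binaryCube n ∧ ∀ y ∈ binaryCube n, ¬ KnapsackDominates w v y x}

/-- The number of Pareto optima of the knapsack problem. -/
noncomputable def numKnapsackPareto {d n : ℕ} (w : Fin n → ℝ) (v : Fin d → Fin n → ℝ) : ℕ :=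
  (knapsackParetoSet w v).ncard

/-! Take `d` items, the `k`-th having profit vector close to the `k`-th unit vector. The hyperplane
`∑ i, l i * p i = 1` through these vectors has a positive normal `l`. With unit weights, the items
in its upper half-space maximize the scalarization `∑ i, l i * v i - w`, so they form a Pareto
optimum (`halfspaceSolution_mem_knapsackParetoSet`). Two such hyperplanes selecting the same items
must each contain the other's defining points (`mem_hyperplane_of_halfspaceSolution_eq`), which
almost surely forces the same tuple (`ae_sum_profitNormal_ne_one`). Drawing one item from each of
`d` blocks of length `n / d` gives `(n / d) ^ d` tuples, each suitable with the same positive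
probability depending only on `d` (`measure_isNearIdentity`). The expectation is thus at least of
order `n ^ d`, more than is claimed. -/

open Matrix in
/-- The objective `∑ i, l i * v i - w` strictly increases along domination when `l > 0`. -/
theorem KnapsackDominates.scalarization_lt {d n : ℕ} {w : Fin n → ℝ} {v : Fin d → Fin n → ℝ}
    {y x : Fin n → ℝ} (h : KnapsackDominates w v y x) {l : Fin d → ℝ} (hl : ∀ i, 0 < l i) :
    ∑ i, l i * (v i ⬝ᵥ x) - w ⬝ᵥ x < ∑ i, l i * (v i ⬝ᵥ y) - w ⬝ᵥ y := by
  obtain ⟨hv, hw, ⟨i, hi⟩ | hlt⟩ := h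
  · have : ∑ i, l i * (v i ⬝ᵥ x) < ∑ i, l i * (v i ⬝ᵥ y) :=
      Finset.sum_lt_sum (fun i _ => mul_le_mul_of_nonneg_left (hv i) (hl i).le)
        ⟨i, Finset.mem_univ i, mul_lt_mul_of_pos_left hi (hl i)⟩
    linarith
  · have : ∑ i, l i * (v i ⬝ᵥ x) ≤ ∑ i, l i * (v i ⬝ᵥ y) :=
      Finset.sum_le_sum (fun i _ => mul_le_mul_of_nonneg_left (hv i) (hl i).le)
    linarith

/-! ### Pareto optima from half-spaces -/

/-- The `0`-`1` vector selecting the items whose profit vectors lie in the half-space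
`1 ≤ ∑ i, l i * p i`. -/
noncomputable def halfspaceSolution {d n : ℕ} (v : Fin d → Fin n → ℝ) (l : Fin d → ℝ) :
    Fin n → ℝ :=
  open Classical in fun j => if 1 ≤ ∑ i, l i * v i j then 1 else 0

theorem sum_mul_dotProduct_sub_one {d n : ℕ} (v : Fin d → Fin n → ℝ) (l : Fin d → ℝ)
    (x : Fin n → ℝ) :
    ∑ i, l i * (v i ⬝ᵥ x) - (fun _ => (1 : ℝ)) ⬝ᵥ x = ∑ j, (∑ i, l i * v i j - 1) * x j := by
  simp only [dotProduct, Finset.mul_sum, sub_mul, Finset.sum_mul, Finset.sum_sub_distrib]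
  rw [Finset.sum_comm]
  simp only [mul_assoc]

/-- Unit weights make the scalarization separate over items with coefficients `∑ i, l i * v i j -
1`; taking exactly the nonnegative ones maximizes it, while a dominating solution would increase it.
-/
theorem halfspaceSolution_mem_knapsackParetoSet {d n : ℕ} (v : Fin d → Fin n → ℝ)
    {l : Fin d → ℝ} (hl : ∀ i, 0 < l i) :
    halfspaceSolution v l ∈ knapsackParetoSet (fun _ => (1 : ℝ)) v := by
  refine ⟨fun j => ?_, fun y hy hdom => ?_⟩
  · unfold halfspaceSolution
    split_ifs <;> simp
  · have h := hdom.scalarization_lt hl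
    rw [sum_mul_dotProduct_sub_one, sum_mul_dotProduct_sub_one] at h
    refine h.not_ge (Finset.sum_le_sum fun j _ => ?_)
    unfold halfspaceSolution
    split_ifs with hj <;> rcases hy j with hy | hy <;> rw [hy] <;> linarith

/-- Covers the case `n < d`, where the blocks are empty. -/
theorem zero_mem_knapsackParetoSet {d n : ℕ} (v : Fin d → Fin n → ℝ) :
    0 ∈ knapsackParetoSet (fun _ => (1 : ℝ)) v := by
  refine ⟨fun j => Or.inl rfl, fun y hy hdom => ?_⟩
  have hy0 : ∀ j, 0 ≤ y j := fun j => by rcases hy j with h | h <;> rw [h]; norm_num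
  have hw : ∑ j, y j ≤ 0 := by simpa [dotProduct] using hdom.2.1
  have hz : y = 0 := by
    funext j
    exact (Finset.sum_eq_zero_iff_of_nonneg fun j _ => hy0 j).1
      (le_antisymm hw (Finset.sum_nonneg fun j _ => hy0 j)) j (Finset.mem_univ j)
  obtain ⟨-, -, ⟨i, hi⟩ | hlt⟩ := hdom <;> simp [hz] at *

theorem finite_binaryCube (n : ℕ) : (binaryCube n).Finite := by
  have : binaryCube n = Set.pi Set.univ fun _ => ({0, 1} : Set ℝ) := by
    ext x
    simp [binaryCube]
  rw [this]
  exact Set.Finite.pi fun _ => Set.toFinite _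

theorem finite_knapsackParetoSet {d n : ℕ} (w : Fin n → ℝ) (v : Fin d → Fin n → ℝ) :
    (knapsackParetoSet w v).Finite :=
  (finite_binaryCube n).subset fun _ hx => hx.1

/-! ### Diagonally dominant matrices -/

/-- Every diagonal entry is within `1 / (4 d)` below `1`, every other one within `1 / (4 d)`
above `0`. -/
def IsNearIdentity {d : ℕ} (M : Matrix (Fin d) (Fin d) ℝ) : Prop :=
  ∀ k i, M k i ∈ if k = i then Set.Icc (1 - 1 / (4 * (d : ℝ))) 1 else Set.Icc 0 (1 / (4 * (d : ℝ)))

/-- The solution `x` of `M x = 1` for invertible `M`. -/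
noncomputable def solveOnes {d : ℕ} (M : Matrix (Fin d) (Fin d) ℝ) : Fin d → ℝ :=
  M⁻¹.mulVec 1

namespace IsNearIdentity

variable {d : ℕ} {M : Matrix (Fin d) (Fin d) ℝ}

theorem transpose (h : IsNearIdentity M) : IsNearIdentity M.transpose := fun k i => by
  simpa [eq_comm] using h i k

theorem le_diag (h : IsNearIdentity M) (k : Fin d) : 3 / 4 ≤ M k k := by
  have h1 := h k k
  rw [if_pos rfl] at h1
  replace h1 := h1.1
  have hd : (1 : ℝ) ≤ d := by exact_mod_cast k.pos
  have : 1 / (4 * (d : ℝ)) ≤ 1 / 4 := by gcongr; linarith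
  linarith

theorem sum_offDiag_le (h : IsNearIdentity M) (k : Fin d) :
    ∑ i ∈ Finset.univ.erase k, |M k i| ≤ 1 / 4 := by
  have hd : (0 : ℝ) < d := by exact_mod_cast k.pos
  have h1 : ∀ i ∈ Finset.univ.erase k, |M k i| ≤ 1 / (4 * (d : ℝ)) := fun i hi => by
    have h2 := h k i
    rw [if_neg (Finset.ne_of_mem_erase hi).symm] at h2
    rw [abs_of_nonneg h2.1]
    exact h2.2
  refine (Finset.sum_le_card_nsmul _ _ _ h1).trans ?_
  rw [nsmul_eq_mul]
  have : ((Finset.univ.erase k).card : ℝ) ≤ d := by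
    exact_mod_cast (Finset.card_erase_le.trans (by simp))
  calc _ ≤ (d : ℝ) * (1 / (4 * d)) := by gcongr
    _ = 1 / 4 := by field_simp

theorem isUnit_det (h : IsNearIdentity M) : IsUnit M.det := by
  refine (det_ne_zero_of_sum_row_lt_diag fun k => ?_).isUnit
  simp only [Real.norm_eq_abs]
  have h1 := h.sum_offDiag_le k
  have h2 := h.le_diag k
  rw [abs_of_nonneg (by linarith : 0 ≤ M k k)]
  linarith

theorem mulVec_solveOnes (h : IsNearIdentity M) : M.mulVec (solveOnes M) = 1 := by
  rw [solveOnes, Matrix.mulVec_mulVec, Matrix.mul_nonsing_inv _ h.isUnit_det, Matrix.one_mulVec]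

theorem sum_mul_solveOnes (h : IsNearIdentity M) (k : Fin d) :
    ∑ i, M k i * solveOnes M i = 1 := congrFun h.mulVec_solveOnes k

/-- At an entry `m` of largest modulus, row `m` gives `3/4 * |l m| ≤ 1 + 1/4 * |l m|`, so all
entries are at most `2` in modulus. The off-diagonal part of each row is then at most `1/2`, leaving
`M k k * l k ≥ 1/2`. -/
theorem solveOnes_pos (h : IsNearIdentity M) (k : Fin d) : 0 < solveOnes M k := by
  set l := solveOnes M
  have hoff : ∀ (L : ℝ), (∀ i, |l i| ≤ L) → ∀ k,
      |∑ i ∈ Finset.univ.erase k, M k i * l i| ≤ 1 / 4 * L := fun L hL k => by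
    have hL0 : 0 ≤ L := (abs_nonneg _).trans (hL k)
    calc |∑ i ∈ Finset.univ.erase k, M k i * l i|
        ≤ ∑ i ∈ Finset.univ.erase k, |M k i * l i| := Finset.abs_sum_le_sum_abs _ _
      _ ≤ ∑ i ∈ Finset.univ.erase k, |M k i| * L := by
          gcongr with i
          rw [abs_mul]
          gcongr
          exact hL i
      _ ≤ 1 / 4 * L := by
          rw [← Finset.sum_mul]
          gcongr
          exact h.sum_offDiag_le k
  have hrow : ∀ k, M k k * l k + ∑ i ∈ Finset.univ.erase k, M k i * l i = 1 := fun k => by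
    rw [Finset.add_sum_erase _ (fun i => M k i * l i) (Finset.mem_univ k)]
    exact h.sum_mul_solveOnes k
  obtain ⟨m, -, hm⟩ := Finset.exists_max_image Finset.univ (fun i => |l i|) ⟨k, Finset.mem_univ k⟩
  have hmax : |l m| ≤ 2 := by
    have h1 := abs_le.1 (hoff |l m| (fun i => hm i (Finset.mem_univ i)) m)
    have h2 : |M m m * l m| ≤ 1 + 1 / 4 * |l m| := by
      rw [abs_le]
      constructor <;> linarith [hrow m, h1.1, h1.2]
    rw [abs_mul, abs_of_nonneg (by linarith [h.le_diag m] : 0 ≤ M m m)] at h2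
    nlinarith [h.le_diag m, abs_nonneg (l m)]
  have h1 := abs_le.1 (hoff 2 (fun i => (hm i (Finset.mem_univ i)).trans hmax) k)
  have h2 : 0 < M k k * l k := by linarith [hrow k, h1.1, h1.2]
  exact pos_of_mul_pos_right h2 (by linarith [h.le_diag k])

/-- Both sides are `1ᵀ M⁻¹ 1`. -/
theorem sum_solveOnes_transpose (h : IsNearIdentity M) :
    ∑ k, solveOnes M.transpose k = ∑ i, solveOnes M i := by
  calc ∑ k, solveOnes M.transpose k
      = ∑ k, solveOnes M.transpose k * ∑ i, M k i * solveOnes M i := by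
        simp [h.sum_mul_solveOnes]
    _ = ∑ i, (∑ k, M.transpose i k * solveOnes M.transpose k) * solveOnes M i := by
        simp only [Finset.mul_sum, Finset.sum_mul, Matrix.transpose_apply]
        rw [Finset.sum_comm]
        refine Finset.sum_congr rfl fun i _ => Finset.sum_congr rfl fun k _ => by ring
    _ = ∑ i, solveOnes M i := by simp only [h.transpose.sum_mul_solveOnes, one_mul]

end IsNearIdentity

/-! ### Comparing hyperplanes through profit vectors -/

/-- The matrix whose rows are the profit vectors of the items `s 0, …, s (d - 1)`. -/
def profitMatrix {d n : ℕ} (v : Fin d → Fin n → ℝ) (s : Fin d → Fin n) :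
    Matrix (Fin d) (Fin d) ℝ :=
  Matrix.of fun k i => v i (s k)

/-- The normal vector of the hyperplane `∑ i, l i * p i = 1` through the profit vectors of the
items `s 0, …, s (d - 1)`. -/
noncomputable def profitNormal {d n : ℕ} (v : Fin d → Fin n → ℝ) (s : Fin d → Fin n) :
    Fin d → ℝ :=
  solveOnes (profitMatrix v s)

section Hyperplanes

variable {d n : ℕ} {v : Fin d → Fin n → ℝ} {s t : Fin d → Fin n}

theorem sum_profitNormal_mul_self (hs : IsNearIdentity (profitMatrix v s)) (k : Fin d) :
    ∑ i, profitNormal v s i * v i (s k) = 1 := by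
  rw [← hs.sum_mul_solveOnes k]
  exact Finset.sum_congr rfl fun i _ => mul_comm _ _

/-- The solution of the transposed system writes the all-ones vector as a positive combination of
the profit vectors of `t`. This turns the signs of `l` at these points into a comparison of the sums
of the two normals. -/
theorem sum_transpose_mul_hyperplane (ht : IsNearIdentity (profitMatrix v t)) (l : Fin d → ℝ) :
    ∑ k, solveOnes (profitMatrix v t).transpose k * (∑ i, l i * v i (t k) - 1) =
      ∑ i, l i - ∑ i, profitNormal v t i := by
  rw [profitNormal, ← ht.sum_solveOnes_transpose]
  simp only [mul_sub, Finset.sum_sub_distrib, mul_one, Finset.mul_sum]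
  congr 1
  rw [Finset.sum_comm]
  refine Finset.sum_congr rfl fun i _ => ?_
  have h := ht.transpose.sum_mul_solveOnes i
  calc _ = l i * ∑ k, (profitMatrix v t).transpose i k *
        solveOnes (profitMatrix v t).transpose k := by
        rw [Finset.mul_sum]
        refine Finset.sum_congr rfl fun k _ => ?_
        simp only [profitMatrix, Matrix.transpose_apply, Matrix.of_apply]
        ring
    _ = l i := by rw [h, mul_one]

theorem one_le_of_halfspaceSolution_eq (ht : IsNearIdentity (profitMatrix v t))
    (hst : halfspaceSolution v (profitNormal v s) = halfspaceSolution v (profitNormal v t))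
    (k : Fin d) : 1 ≤ ∑ i, profitNormal v s i * v i (t k) := by
  have h := congrFun hst (t k)
  unfold halfspaceSolution at h
  -- The item `t k` lies on its own hyperplane, and the half-space is closed, so it is selected.
  rw [if_pos (sum_profitNormal_mul_self ht k).ge] at h
  by_contra hlt
  simp [hlt] at h

theorem sum_profitNormal_le_of_halfspaceSolution_eq (ht : IsNearIdentity (profitMatrix v t))
    (hst : halfspaceSolution v (profitNormal v s) = halfspaceSolution v (profitNormal v t)) :
    ∑ i, profitNormal v t i ≤ ∑ i, profitNormal v s i := by
  rw [← sub_nonneg, ← sum_transpose_mul_hyperplane ht]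
  exact Finset.sum_nonneg fun k _ => mul_nonneg (ht.transpose.solveOnes_pos k).le
    (sub_nonneg.2 (one_le_of_halfspaceSolution_eq ht hst k))

/-- If two hyperplanes select the same items, then each passes through the profit vectors
defining the other one. -/
theorem mem_hyperplane_of_halfspaceSolution_eq (hs : IsNearIdentity (profitMatrix v s))
    (ht : IsNearIdentity (profitMatrix v t))
    (hst : halfspaceSolution v (profitNormal v s) = halfspaceSolution v (profitNormal v t))
    (k : Fin d) : ∑ i, profitNormal v s i * v i (t k) = 1 := by
  have h := sum_transpose_mul_hyperplane ht (profitNormal v s)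
  -- By symmetry the two normals have equal sums, so a positively weighted sum of nonnegative terms
  -- vanishes and each term is zero.
  rw [le_antisymm (sum_profitNormal_le_of_halfspaceSolution_eq hs hst.symm)
    (sum_profitNormal_le_of_halfspaceSolution_eq ht hst), sub_self,
    Finset.sum_eq_zero_iff_of_nonneg fun k _ => mul_nonneg (ht.transpose.solveOnes_pos k).le
      (sub_nonneg.2 (one_le_of_halfspaceSolution_eq ht hst k))] at h
  rcases mul_eq_zero.1 (h k (Finset.mem_univ k)) with h0 | h0
  · exact absurd h0 (ht.transpose.solveOnes_pos k).ne'
  · linarith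

end Hyperplanes

/-! ### Counting block transversals -/

/-- The `a`-th index of the `k`-th of `d` consecutive blocks of length `n / d` in `Fin n`. -/
def blockIndex (d n : ℕ) (k : Fin d) (a : Fin (n / d)) : Fin n :=
  Fin.castLE (Nat.mul_div_le n d) (finProdFinEquiv (k, a))

theorem blockIndex_inj {d n : ℕ} {k k' : Fin d} {a a' : Fin (n / d)} :
    blockIndex d n k a = blockIndex d n k' a' ↔ k = k' ∧ a = a' := by
  rw [blockIndex, blockIndex, (Fin.castLE_injective _).eq_iff, finProdFinEquiv.injective.eq_iff,
    Prod.mk.injEq]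

/-- The transversal of the blocks that `t` describes. -/
def blockTransversal (d n : ℕ) (t : Fin d → Fin (n / d)) : Fin d → Fin n :=
  fun k => blockIndex d n k (t k)

open Classical in
theorem card_isNearIdentity_le_numKnapsackPareto {d n : ℕ} {v : Fin d → Fin n → ℝ}
    (hgen : ∀ (s : Fin d → Fin n) (j : Fin n), j ∉ Set.range s →
      IsNearIdentity (profitMatrix v s) → ∑ i, profitNormal v s i * v i j ≠ 1) :
    (Finset.univ.filter fun t =>
      IsNearIdentity (profitMatrix v (blockTransversal d n t))).card ≤
      numKnapsackPareto (fun _ => (1 : ℝ)) v := by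
  rw [numKnapsackPareto, ← Set.ncard_coe_finset]
  refine Set.ncard_le_ncard_of_injOn
    (fun t => halfspaceSolution v (profitNormal v (blockTransversal d n t)))
    (fun t ht => ?_) (fun t ht t' ht' h => ?_) (finite_knapsackParetoSet _ _)
  · exact halfspaceSolution_mem_knapsackParetoSet v
      fun i => (Finset.mem_filter.1 ht).2.solveOnes_pos i
  · replace ht := (Finset.mem_filter.1 ht).2
    replace ht' := (Finset.mem_filter.1 ht').2
    funext k
    have hk := mem_hyperplane_of_halfspaceSolution_eq ht ht' h k
    by_contra hne
    refine hgen _ _ ?_ ht hk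
    -- Blocks are disjoint: the transversal `t` could meet the item `t' k` of block `k` only at `k`
    -- itself.
    rintro ⟨k', hk'⟩
    obtain ⟨rfl, h⟩ := blockIndex_inj.1 hk'
    exact hne h

/-! ### Measurability and integrability -/

section Measurability

variable {d n : ℕ}

theorem measurable_dotProduct_left (x : Fin n → ℝ) (i : Fin d) :
    Measurable fun v : Fin d → Fin n → ℝ => v i ⬝ᵥ x := by
  unfold dotProduct
  fun_prop

theorem measurableSet_knapsackDominates (w y x : Fin n → ℝ) :
    MeasurableSet {v : Fin d → Fin n → ℝ | KnapsackDominates w v y x} := by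
  simp only [KnapsackDominates, Set.ofPred_and, Set.ofPred_or, Set.ofPred_forall, Set.ofPred_exists]
  exact (MeasurableSet.iInter fun i => measurableSet_le (measurable_dotProduct_left x i)
    (measurable_dotProduct_left y i)).inter ((MeasurableSet.const _).inter
      ((MeasurableSet.iUnion fun i => measurableSet_lt (measurable_dotProduct_left x i)
        (measurable_dotProduct_left y i)).union (MeasurableSet.const _)))

theorem measurableSet_mem_knapsackParetoSet (w x : Fin n → ℝ) :
    MeasurableSet {v : Fin d → Fin n → ℝ | x ∈ knapsackParetoSet w v} := by
  have : {v : Fin d → Fin n → ℝ | x ∈ knapsackParetoSet w v} =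
      {_v | x ∈ binaryCube n} ∩ ⋂ y ∈ binaryCube n, {v | KnapsackDominates w v y x}ᶜ := by
    ext v
    simp [knapsackParetoSet]
  rw [this]
  exact (MeasurableSet.const _).inter (MeasurableSet.biInter (finite_binaryCube n).countable
    fun y _ => (measurableSet_knapsackDominates w y x).compl)

open Classical in
theorem numKnapsackPareto_eq_sum (w : Fin n → ℝ) (v : Fin d → Fin n → ℝ) :
    (numKnapsackPareto w v : ℝ) =
      ∑ x ∈ (finite_binaryCube n).toFinset, if x ∈ knapsackParetoSet w v then 1 else 0 := by
  rw [Finset.sum_boole, numKnapsackPareto, ← Set.ncard_coe_finset]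
  congr 2
  ext x
  simpa using fun h : x ∈ knapsackParetoSet w v => h.1

theorem measurable_numKnapsackPareto (w : Fin n → ℝ) :
    Measurable fun v : Fin d → Fin n → ℝ => (numKnapsackPareto w v : ℝ) := by
  classical
  simp only [numKnapsackPareto_eq_sum]
  exact Finset.measurable_sum _ fun x _ =>
    Measurable.ite (measurableSet_mem_knapsackParetoSet w x) measurable_const measurable_const

theorem numKnapsackPareto_le (w : Fin n → ℝ) (v : Fin d → Fin n → ℝ) :
    numKnapsackPareto w v ≤ (binaryCube n).ncard :=
  Set.ncard_le_ncard (fun _ hx => hx.1) (finite_binaryCube n)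

theorem integrable_numKnapsackPareto {Ω : Type*} [MeasurableSpace Ω] {P : Measure Ω}
    [IsFiniteMeasure P] (w : Fin n → ℝ) {v : Fin d → Fin n → Ω → ℝ}
    (hv : ∀ i j, Measurable (v i j)) :
    Integrable (fun ω => (numKnapsackPareto w fun i j => v i j ω : ℝ)) P := by
  refine Integrable.of_bound (C := (binaryCube n).ncard)
    ((measurable_numKnapsackPareto w).comp
      (measurable_pi_lambda _ fun i => measurable_pi_lambda _ (hv i))).aestronglyMeasurable
    (Filter.Eventually.of_forall fun ω => ?_)
  rw [Real.norm_of_nonneg (Nat.cast_nonneg _)]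
  exact_mod_cast numKnapsackPareto_le w _

/-- The inverse is the adjugate times the inverse of the determinant. Singular matrices fit the same
formula, since `0⁻¹ = 0`. -/
theorem measurable_solveOnes (i : Fin d) :
    Measurable fun M : Fin d → Fin d → ℝ => solveOnes (Matrix.of M) i := by
  have hc : Continuous fun M : Fin d → Fin d → ℝ => Matrix.of M := continuous_id
  have hdet : Measurable fun M : Fin d → Fin d → ℝ => (Matrix.of M).det := by
    have h : Continuous fun M : Fin d → Fin d → ℝ => (Matrix.of M).det := hc.matrix_det
    exact h.measurable
  have hadj : ∀ k, Measurable fun M : Fin d → Fin d → ℝ => (Matrix.of M).adjugate i k := fun k => by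
    have h : Continuous fun M : Fin d → Fin d → ℝ => (Matrix.of M).adjugate i k :=
      hc.matrix_adjugate.matrix_elem i k
    exact h.measurable
  simp only [solveOnes, Matrix.mulVec, dotProduct, Matrix.inv_def, Ring.inverse_eq_inv',
    Matrix.smul_apply, smul_eq_mul]
  exact Finset.measurable_sum _ fun k _ => (hdet.inv.mul (hadj k)).mul measurable_const

theorem measurable_profitNormal (s : Fin d → Fin n) (i : Fin d) :
    Measurable fun v : Fin d → Fin n → ℝ => profitNormal v s i :=
  (measurable_solveOnes i).comp (f := fun (v : Fin d → Fin n → ℝ) k i => v i (s k)) (by fun_prop)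

theorem measurableSet_isNearIdentity :
    MeasurableSet {M : Fin d → Fin d → ℝ | IsNearIdentity (Matrix.of M)} := by
  simp only [IsNearIdentity, Set.ofPred_forall]
  refine MeasurableSet.iInter fun k => MeasurableSet.iInter fun i => ?_
  refine MeasurableSet.preimage (t := if k = i then _ else _) ?_
    (show Measurable fun M : Fin d → Fin d → ℝ => M k i by fun_prop)
  split_ifs <;> exact measurableSet_Icc

end Measurability

/-! ### Independent variables almost surely do not coincide -/

section Independence

variable {Ω : Type*} [MeasurableSpace Ω] {P : Measure Ω}

/-- By Fubini the diagonal is null: its slices are singletons, null for the law of `X`. -/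
theorem ProbabilityTheory.IndepFun.ae_ne [IsFiniteMeasure P] {X Y : Ω → ℝ} (h : IndepFun X Y P)
    (hX : Measurable X) (hY : Measurable Y) [NullSingletonClass (P.map X)] : ∀ᵐ ω ∂P, X ω ≠ Y ω := by
  have hdiag : MeasurableSet {p : ℝ × ℝ | p.1 = p.2} := measurableSet_eq_fun measurable_fst measurable_snd
  have hmap := h.map_prod_eq_prod_map_map hX.aemeasurable hY.aemeasurable
  have h0 : P.map (fun ω => (X ω, Y ω)) {p : ℝ × ℝ | p.1 = p.2} = 0 := by
    rw [hmap, Measure.prod_apply_symm hdiag]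
    simp
  rw [Measure.map_apply (hX.prodMk hY) hdiag] at h0
  simpa [ae_iff] using h0

/-- Independent random variables avoid the values of any measurable function of the others. -/
theorem ProbabilityTheory.iIndepFun.ae_ne_update {ι : Type*} [Fintype ι] [DecidableEq ι]
    [IsFiniteMeasure P] {X : ι → Ω → ℝ} (h : iIndepFun X P) (hX : ∀ i, Measurable (X i)) (i : ι)
    [NullSingletonClass (P.map (X i))] {G : (ι → ℝ) → ℝ} (hG : Measurable G) :
    ∀ᵐ ω ∂P, X i ω ≠ G (Function.update (fun i => X i ω) i 0) := by
  have hind := h.indepFun_finset {i} (Finset.univ.erase i) (by simp) hX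
  let E : (↥(Finset.univ.erase i) → ℝ) → ι → ℝ :=
    fun u k => if hk : k ∈ Finset.univ.erase i then u ⟨k, hk⟩ else 0
  have hE : Measurable E := measurable_pi_lambda _ fun k => by
    by_cases hk : k ∈ Finset.univ.erase i
    · simp only [E, hk, dif_pos]
      exact measurable_pi_apply _
    · simp only [E, hk, dif_neg, not_false_iff]
      exact measurable_const
  have hcomp : IndepFun (X i) ((G ∘ E) ∘ fun ω k => X k ω) P := hind.comp (measurable_pi_apply (⟨i, Finset.mem_singleton_self i⟩ :
    ({i} : Finset ι))) (hG.comp hE)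
  have heq : ∀ ω, E (fun k => X k ω) = Function.update (fun k => X k ω) i 0 := fun ω => by
    funext k
    by_cases hk : k = i
    · subst hk
      simp [E]
    · simp [E, hk]
  filter_upwards [hcomp.ae_ne (hX i) ((hG.comp hE).comp (measurable_pi_lambda _ fun k => hX k))]
    with ω hω
  rw [← heq]
  exact hω

end Independence

/-! ### Uniform laws on the unit interval -/

section Uniform

variable {Ω : Type*} [MeasurableSpace Ω] {P : Measure Ω} {X : Ω → ℝ}

theorem map_eq_restrict_of_isUniform_Icc
    (h : pdf.IsUniform X (Set.Icc (0 : ℝ) 1) P volume) :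
    P.map X = volume.restrict (Set.Icc (0 : ℝ) 1) := by
  rw [h, ProbabilityTheory.cond]
  simp

theorem measure_preimage_Icc_of_isUniform (hX : Measurable X)
    (h : pdf.IsUniform X (Set.Icc (0 : ℝ) 1) P volume) {a b : ℝ} (ha : 0 ≤ a) (hb : b ≤ 1) :
    P (X ⁻¹' Set.Icc a b) = ENNReal.ofReal (b - a) := by
  rw [← Measure.map_apply hX measurableSet_Icc, map_eq_restrict_of_isUniform_Icc h,
    Measure.restrict_apply measurableSet_Icc,
    Set.inter_eq_left.2 (Set.Icc_subset_Icc ha hb), Real.volume_Icc]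

end Uniform

/-! ### General position and expected counts -/

section RandomProfits

variable {Ω : Type*} [MeasurableSpace Ω] {P : Measure Ω} {d n : ℕ}
  {v : Fin d → Fin n → Ω → ℝ}

/-- The normal depends only on the items of `s` and has a positive entry at `i₀`. Lying on the
hyperplane would therefore make `v i₀ j` a function `G` of the other profits, of which it is
independent with an atomless law. -/
theorem ae_sum_profitNormal_ne_one [IsProbabilityMeasure P]
    (hd : 1 ≤ d) (hv : ∀ i j, Measurable (v i j))
    (hu : ∀ i j, pdf.IsUniform (v i j) (Set.Icc (0 : ℝ) 1) P volume)
    (hind : iIndepFun (fun ij : Fin d × Fin n => v ij.1 ij.2) P)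
    (s : Fin d → Fin n) (j : Fin n) (hj : j ∉ Set.range s) :
    ∀ᵐ ω ∂P, IsNearIdentity (profitMatrix (fun i j => v i j ω) s) →
      ∑ i, profitNormal (fun i j => v i j ω) s i * v i j ω ≠ 1 := by
  let i₀ : Fin d := ⟨0, hd⟩
  let G : (Fin d × Fin n → ℝ) → ℝ := fun u =>
    (1 - ∑ i ∈ Finset.univ.erase i₀, profitNormal (fun i j => u (i, j)) s i * u (i, j)) /
      profitNormal (fun i j => u (i, j)) s i₀
  have hN : ∀ i, Measurable fun u : Fin d × Fin n → ℝ => profitNormal (fun i j => u (i, j)) s i :=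
    fun i => (measurable_profitNormal s i).comp
      (f := fun (u : Fin d × Fin n → ℝ) i j => u (i, j)) (by fun_prop)
  have hG : Measurable G := by
    refine Measurable.div (measurable_const.sub (Finset.measurable_sum _ fun i _ =>
      (hN i).mul (measurable_pi_apply _))) (hN i₀)
  have hatoms : NullSingletonClass (P.map (v i₀ j)) := by
    rw [map_eq_restrict_of_isUniform_Icc (hu i₀ j)]
    infer_instance
  have hne := hind.ae_ne_update (fun ij => hv ij.1 ij.2) (i₀, j) hG
  filter_upwards [hne] with ω hω hnear hsum
  refine hω ?_
  have hnormal : profitNormal (fun i j' =>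
      Function.update (fun ij : Fin d × Fin n => v ij.1 ij.2 ω) (i₀, j) 0 (i, j')) s =
      profitNormal (fun i j => v i j ω) s := by
    unfold profitNormal
    congr 1
    ext k i
    have hk : s k ≠ j := fun h => hj ⟨k, h⟩
    simp [profitMatrix, hk]
  have hpos : 0 < profitNormal (fun i j => v i j ω) s i₀ := hnear.solveOnes_pos i₀
  simp only [G, hnormal]
  rw [eq_div_iff hpos.ne', ← hsum, ← Finset.add_sum_erase _ _ (Finset.mem_univ i₀),
    add_sub_assoc, mul_comm, left_eq_add, sub_eq_zero]
  refine Finset.sum_congr rfl fun i hi => ?_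
  simp [Finset.ne_of_mem_erase hi]

/-- Injectivity of `s` makes the `d * d` entries distinct independent profits, each confined to an
interval of length `1 / (4 d)`. -/
theorem measure_isNearIdentity (hv : ∀ i j, Measurable (v i j))
    (hu : ∀ i j, pdf.IsUniform (v i j) (Set.Icc (0 : ℝ) 1) P volume)
    (hind : iIndepFun (fun ij : Fin d × Fin n => v ij.1 ij.2) P)
    {s : Fin d → Fin n} (hs : Function.Injective s) :
    P.real {ω | IsNearIdentity (profitMatrix (fun i j => v i j ω) s)} =
      (1 / (4 * (d : ℝ))) ^ (d * d) := by
  have hinj : Function.Injective fun ki : Fin d × Fin d => (ki.2, s ki.1) := by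
    rintro ⟨k, i⟩ ⟨k', i'⟩ h
    simp only [Prod.mk.injEq] at h ⊢
    exact ⟨hs h.2, h.1⟩
  have hind' := hind.precomp hinj
  let B : Fin d × Fin d → Set ℝ := fun ki =>
    if ki.1 = ki.2 then Set.Icc (1 - 1 / (4 * (d : ℝ))) 1 else Set.Icc 0 (1 / (4 * (d : ℝ)))
  have hB : ∀ ki, MeasurableSet (B ki) := fun ki => by
    simp only [B]
    split_ifs <;> exact measurableSet_Icc
  have hset : {ω | IsNearIdentity (profitMatrix (fun i j => v i j ω) s)} =
      ⋂ ki ∈ (Finset.univ : Finset (Fin d × Fin d)), v ki.2 (s ki.1) ⁻¹' B ki := by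
    ext ω
    simp [IsNearIdentity, profitMatrix, B]
  have hprob : ∀ ki : Fin d × Fin d,
      P (v ki.2 (s ki.1) ⁻¹' B ki) = ENNReal.ofReal (1 / (4 * (d : ℝ))) := fun ki => by
    have hd : (1 : ℝ) ≤ d := by exact_mod_cast ki.1.pos
    have hd1 : 1 / (4 * (d : ℝ)) ≤ 1 := by
      rw [div_le_one (by positivity)]
      linarith
    simp only [B]
    split_ifs
    · rw [measure_preimage_Icc_of_isUniform (hv _ _) (hu _ _) (by linarith) le_rfl, sub_sub_cancel]
    · rw [measure_preimage_Icc_of_isUniform (hv _ _) (hu _ _) le_rfl hd1, sub_zero]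
  have hprod := hind'.measure_inter_preimage_eq_mul Finset.univ (sets := B) fun ki _ => hB ki
  rw [measureReal_def, hset]
  refine (congrArg ENNReal.toReal (hprod.trans (Finset.prod_congr rfl fun ki _ => hprob ki))).trans ?_
  rw [Finset.prod_const, ENNReal.toReal_pow, ENNReal.toReal_ofReal (by positivity)]
  simp

theorem pow_mul_le_integral_numKnapsackPareto [IsProbabilityMeasure P]
    (hd : 1 ≤ d) (hv : ∀ i j, Measurable (v i j))
    (hu : ∀ i j, pdf.IsUniform (v i j) (Set.Icc (0 : ℝ) 1) P volume)
    (hind : iIndepFun (fun ij : Fin d × Fin n => v ij.1 ij.2) P) :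
    ((n / d : ℕ) : ℝ) ^ d * (1 / (4 * (d : ℝ))) ^ (d * d) ≤
      ∫ ω, (numKnapsackPareto (fun _ : Fin n => (1 : ℝ)) (fun i j => v i j ω) : ℝ) ∂P := by
  classical
  let A : (Fin d → Fin (n / d)) → Set Ω := fun t =>
    {ω | IsNearIdentity (profitMatrix (fun i j => v i j ω) (blockTransversal d n t))}
  have hA : ∀ t, MeasurableSet (A t) := fun t =>
    measurableSet_isNearIdentity.preimage
      (f := fun ω k i => v i (blockTransversal d n t k) ω)
      (measurable_pi_lambda _ fun k => measurable_pi_lambda _ fun i => hv i _)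
  have hs : ∀ t, Function.Injective (blockTransversal d n t) := fun t k k' h =>
    (blockIndex_inj.1 h).1
  have hint : ∀ t, Integrable ((A t).indicator fun _ => (1 : ℝ)) P := fun t =>
    (integrable_const 1).indicator (hA t)
  calc ((n / d : ℕ) : ℝ) ^ d * (1 / (4 * (d : ℝ))) ^ (d * d)
      = ∑ t, P.real (A t) := by
        simp only [A, fun t => measure_isNearIdentity hv hu hind (hs t)]
        simp
    _ = ∫ ω, ∑ t, (A t).indicator (fun _ => (1 : ℝ)) ω ∂P := by
        rw [integral_finsetSum _ fun t _ => hint t]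
        exact Finset.sum_congr rfl fun t _ => (integral_indicator_one (hA t)).symm
    _ ≤ _ := by
        refine integral_mono_ae (integrable_finsetSum _ fun t _ => hint t)
          (integrable_numKnapsackPareto _ hv) ?_
        have hgen : ∀ᵐ ω ∂P, ∀ (s : Fin d → Fin n) (j : Fin n), j ∉ Set.range s →
            IsNearIdentity (profitMatrix (fun i j => v i j ω) s) →
              ∑ i, profitNormal (fun i j => v i j ω) s i * v i j ω ≠ 1 := by
          simp only [ae_all_iff]
          exact fun s j hj => ae_sum_profitNormal_ne_one hd hv hu hind s j hj
        filter_upwards [hgen] with ω hω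
        have h := card_isNearIdentity_le_numKnapsackPareto hω
        have hsum : ∑ t, (A t).indicator (fun _ => (1 : ℝ)) ω = (Finset.univ.filter fun t =>
            IsNearIdentity (profitMatrix (fun i j => v i j ω) (blockTransversal d n t))).card := by
          rw [← Finset.sum_boole]
          rfl
        rw [hsum]
        exact_mod_cast h

theorem one_le_integral_numKnapsackPareto [IsProbabilityMeasure P]
    (hv : ∀ i j, Measurable (v i j)) :
    1 ≤ ∫ ω, (numKnapsackPareto (fun _ : Fin n => (1 : ℝ)) (fun i j => v i j ω) : ℝ) ∂P := by
  calc (1 : ℝ) = ∫ _ω, 1 ∂P := by simp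
    _ ≤ _ := by
      refine integral_mono (integrable_const 1) (integrable_numKnapsackPareto _ hv) fun ω => ?_
      have : 1 ≤ numKnapsackPareto (fun _ : Fin n => (1 : ℝ)) (fun i j => v i j ω) :=
        (Set.ncard_pos (finite_knapsackParetoSet _ _)).2 ⟨0, zero_mem_knapsackParetoSet _⟩
      exact Nat.one_le_cast.2 this

end RandomProfits

theorem theorem3 (d : ℕ) (hd : 1 ≤ d) :
    ∃ c : ℝ, 0 < c ∧ ∀ n : ℕ, 1 ≤ n →
      ∀ (Ω : Type*) [MeasurableSpace Ω] (P : Measure Ω) [IsProbabilityMeasure P]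
        (v : Fin d → Fin n → Ω → ℝ),
        (∀ i j, Measurable (v i j)) →
        (∀ i j, pdf.IsUniform (v i j) (Set.Icc (0 : ℝ) 1) P volume) →
        iIndepFun (fun (ij : Fin d × Fin n) => v ij.1 ij.2) P →
        c * (n : ℝ) ^ ((d : ℝ) - 3 / 2) ≤
          ∫ ω, (numKnapsackPareto (fun _ : Fin n => (1 : ℝ)) (fun i j => v i j ω) : ℝ) ∂P := by
  have hd0 : (1 : ℝ) ≤ d := by exact_mod_cast hd
  -- The first factor pays for rounding, `n / (2 d) ≤ ⌊n / d⌋` when `n ≥ d`; the second is the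
  -- probability of a near-identity matrix.
  refine ⟨(1 / (2 * (d : ℝ))) ^ d * (1 / (4 * (d : ℝ))) ^ (d * d), by positivity,
    fun n hn Ω _ P _ v hv hu hind => ?_⟩
  have hn0 : (1 : ℝ) ≤ n := by exact_mod_cast hn
  have hpow : (n : ℝ) ^ ((d : ℝ) - 3 / 2) ≤ (n : ℝ) ^ d := by
    rw [← Real.rpow_natCast]
    exact Real.rpow_le_rpow_of_exponent_le hn0 (by linarith)
  calc (1 / (2 * (d : ℝ))) ^ d * (1 / (4 * (d : ℝ))) ^ (d * d) * (n : ℝ) ^ ((d : ℝ) - 3 / 2)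
      ≤ (1 / (2 * (d : ℝ))) ^ d * (1 / (4 * (d : ℝ))) ^ (d * d) * (n : ℝ) ^ d := by gcongr
    _ = (n / (2 * (d : ℝ))) ^ d * (1 / (4 * (d : ℝ))) ^ (d * d) := by
        rw [mul_right_comm, ← mul_pow, one_div_mul_eq_div]
    _ ≤ _ := by
        rcases lt_or_ge n d with hlt | hge
        · refine le_trans ?_ (one_le_integral_numKnapsackPareto hv)
          have hnd : (n : ℝ) ≤ d := by exact_mod_cast hlt.le
          refine mul_le_one₀ (pow_le_one₀ (by positivity) ?_) (by positivity)
            (pow_le_one₀ (by positivity) ?_)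
          all_goals
            rw [div_le_one (by positivity)]
            linarith
        · refine le_trans ?_ (pow_mul_le_integral_numKnapsackPareto hd hv hu hind)
          -- The remainder of `n` modulo `d` is below `d`, which is at most `d * (n / d)` as the
          -- quotient is positive.
          have hq : n ≤ 2 * d * (n / d) := by
            have h1 := Nat.div_add_mod n d
            have h2 := Nat.mod_lt n hd
            have h3 : d ≤ d * (n / d) := Nat.le_mul_of_pos_right d (Nat.div_pos hge hd)
            rw [mul_assoc]
            omega
          gcongr
          rw [div_le_iff₀ (by positivity), mul_comm]
          exact_mod_cast hq
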